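/- Let $\mathrm{GF}(5)$ be the field with $5$ elements and $V=\mathrm{GF}(5)^2$. A function $f:V\to \mathrm{GF}(5)$ is even if $f(-x)=f(x)$ for all $x\in V$, and bent if $\left|\sum_{x\in V}\zeta^{f(x)-\langle u,x\rangle}\right|=5$ for all $u\in V$, where $\zeta=e^{2\pi i/5}$ and $\langle u,x\rangle=u_0x_0+u_1x_1$. Write $D_a=f^{-1}(a)$ for $a\in \mathrm{GF}(5)$, $a\neq 0$. A function $f$ with $f(0)=0$ gives rise to a weighted partial difference set (weighted PDS) if there are integers $\lambda_{a,b,c}$ and $\mu_{a,b}$ ($a,b,c\in \mathrm{GF}(5)\setminus\{0\}$) such that the list of differences $d-d'$ with $d\in D_a$, $d'\in D_b$ contains every element of $D_c$ exactly $\lambda_{a,b,c}$ times and every nonzero element of $V\setminus\bigcup_{e\ne0}D_e$ exactly $\mu_{a,b}$ times, and if for each $a$ there is a $b$ with $-D_a=D_b$ (which is automatic when $f$ is even). Proposition. There are exactly $1420$ even bent functions $f:V\to \mathrm{GF}(5)$ with $f(0)=0$. The group $G=\mathrm{GL}(2,\mathrm{GF}(5))$ acts on the set $\mathbb{B}$ of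 all these functions by linear changes of variables ($f\sim g$ if and only if $f=g\circ\phi$ for some $\phi\in G$), and there are exactly $11$ orbits $B_1,\dots,B_{11}$, where $|B_1|=40$, $|B_2|=60$, $|B_3|=\dots=|B_9|=120$ and $|B_{10}|=|B_{11}|=240$. The following functions $f_i\in B_i$ are representatives of the orbits: $$\begin{aligned} f_1&=-x_0^2+2x_1^2, & f_2&=-x_0x_1+x_1^2, & f_3&=-2x_0^4+2x_0^2+2x_0x_1,\\ f_4&=-x_1^4+x_0x_1-2x_1^2, & f_5&=x_0^3x_1+2x_1^4, & f_6&=-x_0x_1^3+x_1^4,\\ f_7&=x_1^4-x_0x_1, & f_8&=2x_1^4-2x_0x_1+2x_1^2, & f_9&=-x_0^3x_1+x_1^4,\\ f_{10}&=2x_0x_1^3+x_1^4-x_1^2, & f_{11}&=x_0x_1^3-x_1^4-2x_1^2. && \end{aligned}$$ Among $f_1,\dots,f_{11}$, exactly $f_1,f_2,f_5,f_6,f_9$ give rise to a weighted PDS; and a function in $\mathbb{B}$ gives rise to a weighted PDS if and only if it lies in $B_1\cup B_2\cup B_5\cup B_6\cup B_9$. -/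

import Mathlib

open scoped Matrix

namespace BentGF

/-- The space `GF(p)^n`. -/
abbrev V (p n : ℕ) : Type := Fin n → ZMod p

/-- The Walsh(-Hadamard) transform `W_f(u) = ∑_x ζ^(f(x) - ⟨u, x⟩)`, where `ζ = exp(2πi/p)`;
`ZMod.stdAddChar` is the character `j ↦ ζ^j` of `ZMod p`. -/
noncomputable def walsh {p n : ℕ} [NeZero p] (f : V p n → ZMod p) (u : V p n) : ℂ :=
  ∑ x : V p n, ZMod.stdAddChar (f x - u ⬝ᵥ x)

/-- `f` is bent if `|W_f(u)| = p^(n/2)` for all `u`. -/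
def IsBent {p n : ℕ} [NeZero p] (f : V p n → ZMod p) : Prop :=
  ∀ u : V p n, ‖walsh f u‖ = (p : ℝ) ^ ((n : ℝ) / 2)

/-- The set of all even bent functions `f : GF(p)^n → GF(p)` with `f(0) = 0`. -/
def evenBent (p n : ℕ) [NeZero p] : Set (V p n → ZMod p) :=
  {f | Function.Even f ∧ IsBent f ∧ f 0 = 0}

/-- The group `GL(n, GF(p))` acts on the functions `GF(p)^n → GF(p)` by linear changes of
variables, `(φ • f)(x) = f(φ⁻¹ x)`. So `f` and `g` lie in the same orbit if and only if
`f = g ∘ φ` for some invertible matrix `φ`. -/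
instance glAction (p n : ℕ) :
    MulAction (GL (Fin n) (ZMod p)) (V p n → ZMod p) where
  smul φ f := fun x => f ((φ⁻¹).val *ᵥ x)
  one_smul f := by
    funext x
    change f ((1⁻¹ : GL (Fin n) (ZMod p)).val *ᵥ x) = f x
    simp
  mul_smul φ ψ f := by
    funext x
    change f (((φ * ψ)⁻¹).val *ᵥ x) = f ((ψ⁻¹).val *ᵥ ((φ⁻¹).val *ᵥ x))
    rw [mul_inv_rev, Units.val_mul, Matrix.mulVec_mulVec]

/-- The number of times `g` occurs in the list of differences `d₁ - d₂`, `d₁ ∈ A`, `d₂ ∈ B`. -/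
def diffCount {G : Type*} [AddCommGroup G] [DecidableEq G] (A B : Finset G) (g : G) : ℕ :=
  ((A ×ˢ B).filter (fun d => d.1 - d.2 = g)).card

/-- Weighted `(v, k, lam, mu)`-partial difference sets in a finite abelian group `G`, written
additively. The set is `D = ⋃ i, D i`, with weight set `ι`. -/
structure IsWeightedPDS {G ι : Type*} [AddCommGroup G] [Fintype G] [DecidableEq G]
    (D : ι → Finset G) (v : ℕ) (k : ι → ℕ) (lam : ι → ι → ι → ℕ) (mu : ι → ι → ℕ) : Prop where
  card_group : Fintype.card G = v
  card_part : ∀ i, (D i).card = k i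
  disjoint : ∀ i j, i ≠ j → Disjoint (D i) (D j)
  zero_notMem : ∀ i, 0 ∉ D i
  count_mem : ∀ i j l, ∀ g ∈ D l, g ≠ 0 → diffCount (D i) (D j) g = lam i j l
  count_notMem : ∀ i j, ∀ g, (∀ l, g ∉ D l) → g ≠ 0 → diffCount (D i) (D j) g = mu i j
  neg_part : ∀ i, ∃ j, ∀ g, g ∈ D j ↔ -g ∈ D i

/-- The level curve `D_a = f⁻¹(a)`, for `a ∈ GF(p)`, `a ≠ 0`. -/
def levelCurve {p n : ℕ} [NeZero p] (f : V p n → ZMod p) (a : {a : ZMod p // a ≠ 0}) :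
    Finset (V p n) :=
  Finset.univ.filter (fun x => f x = a.1)

/-- `f` gives rise to a weighted PDS: its level curves `f⁻¹(a)`, `a ≠ 0`, form a weighted PDS
for some parameters. -/
def GivesWeightedPDS {p n : ℕ} [NeZero p] (f : V p n → ZMod p) : Prop :=
  ∃ v k lam mu, IsWeightedPDS (levelCurve f) v k lam mu

/-- The functions `f₁, …, f₁₁` on `GF(5)^2`; `rep i` is `f_{i+1}`. -/
def rep : Fin 11 → V 5 2 → ZMod 5 :=
  ![fun x => -x 0 ^ 2 + 2 * x 1 ^ 2,
    fun x => -(x 0 * x 1) + x 1 ^ 2,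
    fun x => -2 * x 0 ^ 4 + 2 * x 0 ^ 2 + 2 * x 0 * x 1,
    fun x => -x 1 ^ 4 + x 0 * x 1 - 2 * x 1 ^ 2,
    fun x => x 0 ^ 3 * x 1 + 2 * x 1 ^ 4,
    fun x => -(x 0 * x 1 ^ 3) + x 1 ^ 4,
    fun x => x 1 ^ 4 - x 0 * x 1,
    fun x => 2 * x 1 ^ 4 - 2 * x 0 * x 1 + 2 * x 1 ^ 2,
    fun x => -(x 0 ^ 3 * x 1) + x 1 ^ 4,
    fun x => 2 * x 0 * x 1 ^ 3 + x 1 ^ 4 - x 1 ^ 2,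
    fun x => x 0 * x 1 ^ 3 - x 1 ^ 4 - 2 * x 1 ^ 2]

/-- The sizes of the orbits of `f₁, …, f₁₁`. -/
def orbitSize : Fin 11 → ℕ :=
  ![40, 60, 120, 120, 120, 120, 120, 120, 120, 240, 240]

/-- The (shifted) indices of `f₁, f₂, f₅, f₆, f₉`. -/
def pdsIndices : Finset (Fin 11) := {0, 1, 4, 5, 8}

end BentGF

/-!
The classification rests on a combinatorial form of bentness. If `f` is bent, the integral
combination `W_f(u) = ∑ n_j ζ^j`, where `n_j` counts the `x` with `f(x) - ⟨u, x⟩ = j`, has squared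
absolute value `25`. Powers of `ζ` satisfy no integral relations except multiples of
`1 + ζ + ⋯ + ζ^4 = 0`, so this determines the autocorrelations of `n`, and these force
`n` to be a cyclic shift of `(9, 4, 4, 4, 4)` or `(1, 6, 6, 6, 6)` (`isBent_iff_hasPeak`).

In both cases the `n_j` are congruent modulo `5`, so the first and third power moments of
`f - ⟨u, ·⟩` over `GF(5)` vanish for all `u`. Hence `∑ f(x) = 0` and `∑ f(x) ⟨u, x⟩^2 = 0`, which
says that an even bent `f` has no terms of degree `6` or `8`. So `f = q + v`, where `q` is a
quadratic form and `v`, homogeneous of degree `4`, is constant on the nonzero vectors of each of the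
six lines through `0` (`exists_quad_of_bent`); the six values add up to `0`, as `∑ f(x) = 0`.

A linear change of variables takes `q` to one of five normal forms (`exists_normalForm`). For each
of them there are `5^5` functions `v`; a kernel computation shows that each `q + v` either has a
wrong value distribution for some `u` or is equivalent to one of the representatives
(`exists_mem_orbit_rep`). Orbit sizes follow from the orders of the stabilizers, and
inequivalence of the representatives from the absence of matrices carrying one to the other
(`countPullback_table`); the total `1420` is the sum of the orbit sizes.

For an even function the property of giving rise to a weighted PDS only concerns the numbers of
representations of nonzero elements as differences (`givesWeightedPDS_iff`). It is invariant under
linear changes of variables, so it only has to be decided for the representatives.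

All finite computations are arranged on natural numbers, with functions stored as base-5 numerals
and value distributions as base-32 numerals, which the kernel evaluates quickly.
-/

namespace BentGF

/-! ### Value distributions of bent functions -/

open Polynomial in
/-- The only integral relations between the `p`-th roots of unity `1, ζ, …, ζ^(p-1)` are the
multiples of `1 + ζ + ⋯ + ζ^(p-1) = 0`, because the `p`-th cyclotomic polynomial is the minimal
polynomial of `ζ`. -/
theorem coeff_eq_of_sum_stdAddChar_eq_zero {p : ℕ} [Fact p.Prime] (c : ZMod p → ℤ)
    (h : ∑ j, (c j : ℂ) * ZMod.stdAddChar j = 0) (i j : ZMod p) : c i = c j := by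
  have hp : p.Prime := Fact.out
  set ζ : ℂ := ZMod.stdAddChar (1 : ZMod p) with hζ
  have hpow : ∀ j : ZMod p, ZMod.stdAddChar j = ζ ^ j.val := fun j => by
    rw [hζ, ← AddChar.map_nsmul_eq_pow, nsmul_one, ZMod.natCast_zmod_val]
  have hprim : IsPrimitiveRoot ζ p := by
    have hne : ζ ≠ 1 := by
      rw [hζ, ← AddChar.map_zero_eq_one (ZMod.stdAddChar (N := p))]
      exact fun h' => one_ne_zero (ZMod.injective_stdAddChar h')
    have hp1 : ζ ^ p = 1 := by
      rw [hζ, ← AddChar.map_nsmul_eq_pow]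
      simp
    exact IsPrimitiveRoot.iff_orderOf.2 (orderOf_eq_prime hp1 hne)
  let P : ℚ[X] := ∑ j : ZMod p, C (c j : ℚ) * X ^ j.val
  have hcoeff : ∀ j : ZMod p, P.coeff j.val = c j := fun j => by
    simp only [P, finsetSum_coeff, coeff_C_mul, coeff_X_pow]
    rw [Finset.sum_eq_single j]
    · simp
    · intro b _ hb
      rw [if_neg, mul_zero]
      exact fun h' => hb (ZMod.val_injective p h'.symm)
    · simp
  have hroot : aeval ζ P = 0 := by
    simp only [P, map_sum, map_mul, map_pow, aeval_X, aeval_C]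
    rw [← h]
    exact Finset.sum_congr rfl fun j _ => by rw [hpow]; simp
  obtain ⟨R, hR⟩ : cyclotomic p ℚ ∣ P := by
    rw [cyclotomic_eq_minpoly_rat hprim hp.pos]
    exact minpoly.dvd ℚ ζ hroot
  have hdeg : P.natDegree ≤ p - 1 := by
    refine natDegree_sum_le_of_forall_le _ _ fun j _ => ?_
    exact (natDegree_C_mul_X_pow_le _ _).trans (Nat.le_sub_one_of_lt (ZMod.val_lt j))
  have hRdeg : R.natDegree = 0 := by
    by_cases hR0 : R = 0
    · simp [hR0]
    · rw [hR, natDegree_mul (cyclotomic_ne_zero p ℚ) hR0, natDegree_cyclotomic,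
        Nat.totient_prime hp] at hdeg
      omega
  obtain ⟨r, rfl⟩ : ∃ r, R = C r := ⟨_, eq_C_of_natDegree_eq_zero hRdeg⟩
  have key : ∀ j : ZMod p, (c j : ℚ) = r := fun j => by
    rw [← hcoeff, hR, coeff_mul_C, cyclotomic_prime]
    simp [coeff_X_pow, ZMod.val_lt j]
  exact_mod_cast (key i).trans (key j).symm

/-- The number of `x` with `f x - ⟨u, x⟩ = j`. -/
def levelCount (f : V 5 2 → ZMod 5) (u : V 5 2) (j : ZMod 5) : ℕ :=
  (Finset.univ.filter fun x => f x - u ⬝ᵥ x = j).card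

theorem walsh_eq_sum_levelCount (f : V 5 2 → ZMod 5) (u : V 5 2) :
    walsh f u = ∑ j, (levelCount f u j : ℂ) * ZMod.stdAddChar j := by
  unfold walsh levelCount
  rw [← Finset.sum_fiberwise Finset.univ (fun x => f x - u ⬝ᵥ x)]
  refine Finset.sum_congr rfl fun j _ => ?_
  rw [Finset.sum_congr rfl (g := fun _ => ZMod.stdAddChar j), Finset.sum_const, nsmul_eq_mul]
  intro x hx
  rw [(Finset.mem_filter.1 hx).2]

theorem sum_levelCount (f : V 5 2 → ZMod 5) (u : V 5 2) : ∑ j, levelCount f u j = 25 := by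
  unfold levelCount
  rw [← Finset.card_eq_sum_card_fiberwise (fun x _ => Finset.mem_univ _)]
  simp [Finset.card_univ]

/-- The squared absolute value of `∑ c j ζ^j` is the sum of the autocorrelations of `c`,
weighted by the powers of `ζ`. -/
theorem norm_sq_sum_stdAddChar {p : ℕ} [NeZero p] (c : ZMod p → ℕ) :
    ((‖∑ j, (c j : ℂ) * ZMod.stdAddChar j‖ ^ 2 : ℝ) : ℂ) =
      ∑ t, ((∑ j, c (j + t) * c j : ℕ) : ℂ) * ZMod.stdAddChar t := by
  rw [← Complex.normSq_eq_norm_sq, ← Complex.mul_conj, map_sum, Finset.sum_mul_sum,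
    Finset.sum_comm]
  simp only [Nat.cast_sum, Finset.sum_mul]
  rw [Finset.sum_comm (s := Finset.univ) (t := Finset.univ)
    (f := fun t j => ((c (j + t) * c j : ℕ) : ℂ) * ZMod.stdAddChar t)]
  refine Finset.sum_congr rfl fun j _ => ?_
  rw [← Equiv.sum_comp (Equiv.addLeft j)]
  refine Finset.sum_congr rfl fun t _ => ?_
  rw [map_mul, ← AddChar.map_neg_eq_conj, Complex.conj_natCast, Equiv.coe_addLeft,
    AddChar.map_add_eq_mul, AddChar.map_neg_eq_inv]
  have : (ZMod.stdAddChar j : ℂ) ≠ 0 := by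
    rw [ZMod.stdAddChar_apply]; exact Circle.coe_ne_zero _
  push_cast
  field_simp

/-- The distribution `n` is constant on `GF(5)` except at one value `k`, being `(9, 4, 4, 4, 4)`
or `(1, 6, 6, 6, 6)` up to a cyclic shift. Then `∑ n j ζ^j` is `5 ζ^k` or `-5 ζ^k`. -/
def HasPeak (n : ZMod 5 → ℕ) : Prop :=
  ∃ k, (∀ j, n j = if j = k then 9 else 4) ∨ (∀ j, n j = if j = k then 1 else 6)

instance (n : ZMod 5 → ℕ) : Decidable (HasPeak n) := by unfold HasPeak; infer_instance

set_option synthInstance.maxSize 2000 in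
theorem hasPeak_of_lt_ten : ∀ a < 10, ∀ b < 10, ∀ c < 10, ∀ d < 10,
    a + b + c + d ≤ 25 →
    a ^ 2 + b ^ 2 + c ^ 2 + d ^ 2 + (25 - a - b - c - d) ^ 2 = 145 →
    a * b + b * c + c * d + d * (25 - a - b - c - d) + (25 - a - b - c - d) * a = 120 →
    HasPeak (fun j => (![a, b, c, d, 25 - a - b - c - d] : Fin 5 → ℕ) j) := by
  decide +kernel

theorem zmod_five_cases (v : ZMod 5) : v = 0 ∨ v = 1 ∨ v = 2 ∨ v = 3 ∨ v = 4 := by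
  revert v; decide

theorem forall_zmod_five {P : ZMod 5 → Prop} :
    (∀ v, P v) ↔ P 0 ∧ P 1 ∧ P 2 ∧ P 3 ∧ P 4 :=
  ⟨fun h => ⟨h 0, h 1, h 2, h 3, h 4⟩, fun ⟨h0, h1, h2, h3, h4⟩ v => by
    rcases zmod_five_cases v with rfl | rfl | rfl | rfl | rfl <;> assumption⟩

theorem sum_zmod_five {M : Type*} [AddCommMonoid M] (g : ZMod 5 → M) :
    ∑ j, g j = g 0 + g 1 + g 2 + g 3 + g 4 :=
  Fin.sum_univ_five g

/-- A distribution of 25 points with the autocorrelations of `(9, 4, 4, 4, 4)` has a peak: the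
bound `∑ (n j - 5)^2 = 20` leaves finitely many candidates. -/
theorem hasPeak_of_autocorrelation (n : ZMod 5 → ℕ) (hsum : ∑ j, n j = 25)
    (h0 : ∑ j, n (j + 0) * n j = 145) (h1 : ∑ j, n (j + 1) * n j = 120) : HasPeak n := by
  have e0 : n 0 + n 1 + n 2 + n 3 + n 4 = 25 := by
    rw [← hsum, sum_zmod_five]
  have e1 : n 0 * n 0 + n 1 * n 1 + n 2 * n 2 + n 3 * n 3 + n 4 * n 4 = 145 := by
    rw [← h0, sum_zmod_five]; simp only [add_zero]
  have e2 : n 1 * n 0 + n 2 * n 1 + n 3 * n 2 + n 4 * n 3 + n 0 * n 4 = 120 := by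
    rw [← h1, sum_zmod_five]; rfl
  have small : ∀ j, n j < 10 := fun j => by
    have : (n j - 5 : ℤ) ^ 2 ≤ 20 := by
      have hz0 : (n 0 + n 1 + n 2 + n 3 + n 4 : ℤ) = 25 := by exact_mod_cast e0
      have hz1 : (n 0 * n 0 + n 1 * n 1 + n 2 * n 2 + n 3 * n 3 + n 4 * n 4 : ℤ) = 145 := by
        exact_mod_cast e1
      have : (n 0 - 5 : ℤ) ^ 2 + (n 1 - 5 : ℤ) ^ 2 + (n 2 - 5 : ℤ) ^ 2 + (n 3 - 5 : ℤ) ^ 2 +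
          (n 4 - 5 : ℤ) ^ 2 = 20 := by linear_combination hz1 - 10 * hz0
      have p0 := sq_nonneg (n 0 - 5 : ℤ)
      have p1 := sq_nonneg (n 1 - 5 : ℤ)
      have p2 := sq_nonneg (n 2 - 5 : ℤ)
      have p3 := sq_nonneg (n 3 - 5 : ℤ)
      have p4 := sq_nonneg (n 4 - 5 : ℤ)
      rcases zmod_five_cases j with rfl | rfl | rfl | rfl | rfl <;> linarith
    by_contra! hj
    have : (10 : ℤ) ≤ n j := by exact_mod_cast hj
    nlinarith
  have e4 : n 4 = 25 - n 0 - n 1 - n 2 - n 3 := by omega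
  have := hasPeak_of_lt_ten _ (small 0) _ (small 1) _ (small 2) _ (small 3) (by omega)
    (by rw [← e4, ← e1]; ring) (by rw [← e4, ← e2]; ring)
  convert this using 1
  rw [← e4]
  funext j
  rcases zmod_five_cases j with rfl | rfl | rfl | rfl | rfl <;> rfl

-- Local, since it offers a second route to the ring structure of `ZMod 5`.
local instance fact_prime_five : Fact (Nat.Prime 5) := ⟨by norm_num⟩

/-- The combinatorial form of bentness. Comparing coefficients in `|W_f(u)|² = 25` gives the
autocorrelations `145, 120, 120, 120, 120` of the value distribution of `f - ⟨u, ·⟩`. -/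
theorem isBent_iff_hasPeak (f : V 5 2 → ZMod 5) :
    IsBent f ↔ ∀ u, HasPeak (levelCount f u) := by
  refine forall_congr' fun u => ?_
  rw [show ((5 : ℕ) : ℝ) ^ (((2 : ℕ) : ℝ) / 2) = 5 by norm_num, walsh_eq_sum_levelCount]
  set n := levelCount f u with hn
  have hsum : ∑ j, n j = 25 := sum_levelCount f u
  constructor
  · intro h
    have hsq := norm_sq_sum_stdAddChar n
    rw [h] at hsq
    set R : ZMod 5 → ℕ := fun t => ∑ j, n (j + t) * n j with hR
    have hz : ∑ t, (((R t : ℤ) - if t = 0 then 25 else 0 : ℤ) : ℂ) * ZMod.stdAddChar t = 0 := by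
      simp only [Int.cast_sub, sub_mul, Finset.sum_sub_distrib, Int.cast_natCast]
      rw [← hsq]
      simp
      norm_num
    have heq := coeff_eq_of_sum_stdAddChar_eq_zero _ hz
    have hR1 : ∀ t, t ≠ 0 → R t = R 1 := fun t ht => by
      simpa [ht] using heq t 1
    have hR0 : (R 0 : ℤ) - 25 = R 1 := by simpa using heq 0 1
    have htot : ∑ t, R t = 625 := by
      simp only [hR]
      rw [Finset.sum_comm]
      have : ∀ j, ∑ t, n (j + t) * n j = 25 * n j := fun j => by
        rw [← Finset.sum_mul, ← hsum]
        exact congrArg (· * n j) (Equiv.sum_comp (Equiv.addLeft j) n)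
      simp only [this, ← Finset.mul_sum, hsum]
      rfl
    rw [sum_zmod_five, hR1 2 (by decide), hR1 3 (by decide), hR1 4 (by decide)] at htot
    exact hasPeak_of_autocorrelation n hsum (show R 0 = 145 by omega) (show R 1 = 120 by omega)
  · have hz : ∑ j : ZMod 5, (ZMod.stdAddChar j : ℂ) = 0 :=
      AddChar.sum_eq_zero_of_ne_one fun h => by
        have h1 : (ZMod.stdAddChar (1 : ZMod 5) : ℂ) = ZMod.stdAddChar (0 : ZMod 5) := by simp [h]
        exact absurd (ZMod.injective_stdAddChar h1) (by decide)
    have hnorm : ∀ k : ZMod 5, ‖(ZMod.stdAddChar k : ℂ)‖ = 1 := fun k => by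
      rw [ZMod.stdAddChar_apply]; exact Circle.norm_coe _
    rintro ⟨k, hk | hk⟩
    · have : ∑ j, (n j : ℂ) * ZMod.stdAddChar j = 5 * ZMod.stdAddChar k := by
        have : ∀ j, (n j : ℂ) * ZMod.stdAddChar j =
            4 * ZMod.stdAddChar j + if j = k then 5 * ZMod.stdAddChar k else 0 := fun j => by
          rw [hk]; split_ifs with h
          · subst h; push_cast; ring
          · push_cast; ring
        simp [this, Finset.sum_add_distrib, ← Finset.mul_sum, hz]
      rw [this, norm_mul, hnorm]; norm_num
    · have : ∑ j, (n j : ℂ) * ZMod.stdAddChar j = -5 * ZMod.stdAddChar k := by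
        have : ∀ j, (n j : ℂ) * ZMod.stdAddChar j =
            6 * ZMod.stdAddChar j + if j = k then -5 * ZMod.stdAddChar k else 0 := fun j => by
          rw [hk]; split_ifs with h
          · subst h; push_cast; ring
          · push_cast; ring
        simp [this, Finset.sum_add_distrib, ← Finset.mul_sum, hz]
      rw [this, norm_mul, hnorm]; norm_num

/-! ### Linear changes of variables -/

theorem smul_apply {p n : ℕ} (φ : GL (Fin n) (ZMod p)) (f : V p n → ZMod p) (x : V p n) :
    (φ • f) x = f ((φ⁻¹).val *ᵥ x) := rfl

theorem inv_val_mulVec_val_mulVec {p n : ℕ} (φ : GL (Fin n) (ZMod p)) (x : V p n) :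
    (φ⁻¹).val *ᵥ (φ.val *ᵥ x) = x := by
  rw [Matrix.mulVec_mulVec, ← Units.val_mul, inv_mul_cancel, Units.val_one, Matrix.one_mulVec]

theorem val_mulVec_inv_val_mulVec {p n : ℕ} (φ : GL (Fin n) (ZMod p)) (x : V p n) :
    φ.val *ᵥ ((φ⁻¹).val *ᵥ x) = x := by
  rw [Matrix.mulVec_mulVec, ← Units.val_mul, mul_inv_cancel, Units.val_one, Matrix.one_mulVec]

/-- The change of variables `x ↦ φ x` as a permutation of `GF(p)^n`. -/
def mulVecEquiv {p n : ℕ} (φ : GL (Fin n) (ZMod p)) : V p n ≃ V p n where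
  toFun x := φ.val *ᵥ x
  invFun x := (φ⁻¹).val *ᵥ x
  left_inv := inv_val_mulVec_val_mulVec φ
  right_inv := val_mulVec_inv_val_mulVec φ

theorem walsh_smul {p n : ℕ} [NeZero p] (φ : GL (Fin n) (ZMod p)) (f : V p n → ZMod p)
    (u : V p n) : walsh (φ • f) u = walsh f (u ᵥ* φ.val) := by
  unfold walsh
  rw [← Equiv.sum_comp (mulVecEquiv φ)]
  refine Finset.sum_congr rfl fun x _ => ?_
  rw [smul_apply]
  change ZMod.stdAddChar (f ((φ⁻¹).val *ᵥ (φ.val *ᵥ x)) - u ⬝ᵥ (φ.val *ᵥ x)) = _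
  rw [inv_val_mulVec_val_mulVec, Matrix.dotProduct_mulVec]

theorem smul_mem_evenBent {p n : ℕ} [NeZero p] (φ : GL (Fin n) (ZMod p)) {f : V p n → ZMod p}
    (hf : f ∈ evenBent p n) : φ • f ∈ evenBent p n := by
  obtain ⟨heven, hbent, h0⟩ := hf
  refine ⟨fun x => ?_, fun u => ?_, ?_⟩
  · rw [smul_apply, smul_apply, Matrix.mulVec_neg, heven]
  · rw [walsh_smul]
    exact hbent _
  · rw [smul_apply, Matrix.mulVec_zero, h0]

/-- `f = g ∘ A` for the matrix `A` with rows `(a, b)`, `(c, d)`. -/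
def IsPullback (f g : V 5 2 → ZMod 5) (a b c d : ZMod 5) : Prop :=
  a * d - b * c ≠ 0 ∧ ∀ x, f x = g (!![a, b; c, d] *ᵥ x)

theorem mem_orbit_iff (f g : V 5 2 → ZMod 5) :
    f ∈ MulAction.orbit (GL (Fin 2) (ZMod 5)) g ↔ ∃ a b c d, IsPullback f g a b c d := by
  constructor
  · rintro ⟨φ, rfl⟩
    have hdet : (φ⁻¹).val.det ≠ 0 := Matrix.GeneralLinearGroup.det_ne_zero _
    rw [Matrix.det_fin_two] at hdet
    refine ⟨_, _, _, _, hdet, fun x => ?_⟩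
    rw [← Matrix.eta_fin_two]
    rfl
  · rintro ⟨a, b, c, d, hdet, h⟩
    refine ⟨(Matrix.GeneralLinearGroup.mkOfDetNeZero !![a, b; c, d]
      (by rwa [Matrix.det_fin_two_of]))⁻¹, ?_⟩
    funext x
    simp only [smul_apply, inv_inv]
    exact (h x).symm

instance (f g : V 5 2 → ZMod 5) (a b c d : ZMod 5) : Decidable (IsPullback f g a b c d) := by
  unfold IsPullback; infer_instance

/-- The number of `φ ∈ GL(2, 5)` with `f = g ∘ φ`. The entries of the first column of `φ` are
summed over first, since they determine the value of `g ∘ φ` at `(1, 0)`. -/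
def pullbackCount (f g : V 5 2 → ZMod 5) : ℕ :=
  ∑ a, ∑ c, ∑ b, ∑ d, if IsPullback f g a b c d then 1 else 0

theorem pullbackCount_eq_zero_iff (f g : V 5 2 → ZMod 5) :
    pullbackCount f g = 0 ↔ f ∉ MulAction.orbit (GL (Fin 2) (ZMod 5)) g := by
  rw [mem_orbit_iff]
  simp only [pullbackCount, Finset.sum_eq_zero_iff, Finset.mem_univ, true_implies,
    ite_eq_right_iff, one_ne_zero, imp_false, not_exists]
  exact ⟨fun h a b c d => h a c b d, fun h a c b d => h a b c d⟩

theorem card_stabilizer (f : V 5 2 → ZMod 5) :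
    Nat.card (MulAction.stabilizer (GL (Fin 2) (ZMod 5)) f) = pullbackCount f f := by
  have e : MulAction.stabilizer (GL (Fin 2) (ZMod 5)) f ≃
      {t : ((ZMod 5 × ZMod 5) × ZMod 5) × ZMod 5 // IsPullback f f t.1.1.1 t.1.2 t.1.1.2 t.2} :=
    { toFun := fun φ => ⟨(((φ.1.val 0 0, φ.1.val 1 0), φ.1.val 0 1), φ.1.val 1 1), by
        have hdet : φ.1.val.det ≠ 0 := Matrix.GeneralLinearGroup.det_ne_zero _
        rw [Matrix.det_fin_two] at hdet
        refine ⟨hdet, fun x => ?_⟩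
        rw [← Matrix.eta_fin_two]
        have := congrFun φ.2 (φ.1.val *ᵥ x)
        rw [← this]
        exact congrArg f (inv_val_mulVec_val_mulVec φ.1 x).symm⟩
      invFun := fun t => ⟨Matrix.GeneralLinearGroup.mkOfDetNeZero
          !![t.1.1.1.1, t.1.1.2; t.1.1.1.2, t.1.2] (by
            rw [Matrix.det_fin_two_of]; exact t.2.1), by
        rw [MulAction.mem_stabilizer_iff, smul_eq_iff_eq_inv_smul]
        funext x
        rw [smul_apply, inv_inv]
        exact t.2.2 x⟩
      left_inv := fun φ => by
        ext i j
        fin_cases i <;> fin_cases j <;> rfl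
      right_inv := fun t => rfl }
  rw [Nat.card_congr e, Nat.card_eq_fintype_card, Fintype.card_subtype, Finset.card_filter]
  simp only [pullbackCount, Fintype.sum_prod_type]

theorem ncard_orbit_mul_pullbackCount (f : V 5 2 → ZMod 5) :
    (MulAction.orbit (GL (Fin 2) (ZMod 5)) f).ncard * pullbackCount f f = 480 := by
  rw [← card_stabilizer, ← Nat.card_coe_set_eq, ← Nat.card_prod,
    Nat.card_congr (MulAction.orbitProdStabilizerEquivGroup _ f), Matrix.card_GL_field]
  simp [Fin.prod_univ_two, ZMod.card]

/-! ### The quadratic part of an even bent function -/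

/-- The power moments of `f - ⟨u, ·⟩` vanish in `GF(5)` in every degree in which those of the
identity do: the numbers `9, 4` are congruent modulo `5`, and so are `1, 6`. -/
theorem sum_pow_sub_dotProduct (f : V 5 2 → ZMod 5) (u : V 5 2) (h : HasPeak (levelCount f u))
    (m : ℕ) (hm : ∑ j : ZMod 5, j ^ m = 0) : ∑ x, (f x - u ⬝ᵥ x) ^ m = 0 := by
  have h1 : ∑ x, (f x - u ⬝ᵥ x) ^ m = ∑ j, (levelCount f u j : ZMod 5) * j ^ m := by
    rw [← Finset.sum_fiberwise Finset.univ (fun x => f x - u ⬝ᵥ x)]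
    refine Finset.sum_congr rfl fun j _ => ?_
    rw [Finset.sum_congr rfl (g := fun _ => j ^ m), Finset.sum_const, nsmul_eq_mul]
    · rfl
    · intro x hx
      rw [(Finset.mem_filter.1 hx).2]
  have h2 : ∃ r : ZMod 5, ∀ j, (levelCount f u j : ZMod 5) = r := by
    obtain ⟨k, hk | hk⟩ := h
    · exact ⟨4, fun j => by rw [hk]; split_ifs <;> rfl⟩
    · exact ⟨1, fun j => by rw [hk]; split_ifs <;> rfl⟩
  obtain ⟨r, hr⟩ := h2
  simp only [h1, hr, ← Finset.mul_sum, hm, mul_zero]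

theorem sum_eq_zero_of_bent {f : V 5 2 → ZMod 5} (h : ∀ u, HasPeak (levelCount f u)) :
    ∑ x, f x = 0 := by
  simpa using sum_pow_sub_dotProduct f 0 (h 0) 1 (by decide)

/-- Polarization of the vanishing third moments of `f - ⟨u, ·⟩`, `f + ⟨u, ·⟩` and `f`. This says
that the monomials of degree `6` do not occur in an even bent function. -/
theorem sum_mul_sq_eq_zero_of_bent {f : V 5 2 → ZMod 5} (h : ∀ u, HasPeak (levelCount f u))
    (u : V 5 2) : ∑ x, f x * (u ⬝ᵥ x) ^ 2 = 0 := by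
  have h3 : ∑ j : ZMod 5, j ^ 3 = 0 := by decide
  have e1 := sum_pow_sub_dotProduct f u (h u) 3 h3
  have e2 := sum_pow_sub_dotProduct f (-u) (h (-u)) 3 h3
  have e0 := sum_pow_sub_dotProduct f 0 (h 0) 3 h3
  have : ∑ x, f x * (u ⬝ᵥ x) ^ 2 = ∑ x, (f x - u ⬝ᵥ x) ^ 3 + ∑ x, (f x - -u ⬝ᵥ x) ^ 3 -
      2 * ∑ x, (f x - 0 ⬝ᵥ x) ^ 3 := by
    rw [Finset.mul_sum, ← Finset.sum_add_distrib, ← Finset.sum_sub_distrib]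
    refine Finset.sum_congr rfl fun x _ => ?_
    rw [neg_dotProduct, zero_dotProduct]
    have h5 : (5 : ZMod 5) = 0 := rfl
    linear_combination (- f x * (u ⬝ᵥ x) ^ 2) * h5
  rw [this, e1, e2, e0]
  ring

theorem sum_V {M : Type*} [AddCommMonoid M] (g : V 5 2 → M) : ∑ x, g x = ∑ a, ∑ b, g ![a, b] := by
  rw [← Equiv.sum_comp (finTwoArrowEquiv (ZMod 5)).symm, Fintype.sum_prod_type]
  rfl

/-- Representatives of the twelve pairs `{x, -x}` of nonzero vectors of `GF(5)^2`, with natural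
numbers as coordinates: first one vector on each of the six lines through `0`, then their
doubles (up to sign) in the same order. -/
def points : List (ℕ × ℕ) :=
  [(1, 0), (0, 1), (1, 1), (1, 2), (1, 3), (1, 4), (2, 0), (0, 2), (2, 2), (2, 4), (2, 1), (2, 3)]

/-- The vector with the given coordinates. -/
def toV (p : ℕ × ℕ) : V 5 2 := ![(p.1 : ZMod 5), (p.2 : ZMod 5)]

theorem eq_zero_or_mem_points (x : V 5 2) :
    x = 0 ∨ ∃ p ∈ points, x = toV p ∨ x = -toV p := by
  revert x; decide +kernel

theorem sum_points {M : Type*} [AddCommMonoid M] (g : V 5 2 → M) :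
    ∑ x, g x = g 0 + (points.map fun p => g (toV p) + g (-toV p)).sum := by
  have hp : ∀ a b c d : ZMod 5, -a = c → -b = d → -(![a, b] : V 5 2) = ![c, d] := by
    rintro a b _ _ rfl rfl; simp
  have h0 : (0 : V 5 2) = ![0, 0] := by decide
  rw [sum_V]
  simp only [sum_zmod_five, points, List.map_cons, List.map_nil, List.sum_cons, List.sum_nil, toV,
    Nat.cast_zero, Nat.cast_one, Nat.cast_ofNat, h0]
  rw [hp 1 0 4 0 rfl rfl, hp 0 1 0 4 rfl rfl, hp 1 1 4 4 rfl rfl, hp 1 2 4 3 rfl rfl,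
    hp 1 3 4 2 rfl rfl, hp 1 4 4 1 rfl rfl, hp 2 0 3 0 rfl rfl, hp 0 2 0 3 rfl rfl,
    hp 2 2 3 3 rfl rfl, hp 2 4 3 1 rfl rfl, hp 2 1 3 4 rfl rfl, hp 2 3 3 2 rfl rfl]
  abel

theorem sum_even {R : Type*} [CommSemiring R] {g : V 5 2 → R} (hg : Function.Even g) :
    ∑ x, g x = g 0 + 2 * (points.map fun p => g (toV p)).sum := by
  rw [sum_points, ← List.sum_map_mul_left]
  simp only [hg _, two_mul]

/-- The binary quadratic form with coefficients `a, b, c`. -/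
def quad (a b c : ZMod 5) (x : V 5 2) : ZMod 5 := a * x 0 ^ 2 + b * (x 0 * x 1) + c * x 1 ^ 2

/-- The quadratic part `q` of `f`. Passing from `f(x)` to `f(x) - f(2x)` cancels the terms of
degrees `4` and `8` and doubles those of degrees `2` and `6`, as `2^4 = 1` and `2^2 = 2^6 = -1`; and
there are no terms of degree `6`. -/
theorem exists_quad_of_bent {f : V 5 2 → ZMod 5} (hf : Function.Even f) (h0 : f 0 = 0)
    (hb : ∀ u, HasPeak (levelCount f u)) :
    ∃ a b c, ∀ x, f x - f ((2 : ZMod 5) • x) = 2 * quad a b c x := by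
  have hev : ∀ u : V 5 2, Function.Even fun x => f x * (u ⬝ᵥ x) ^ 2 := fun u x => by
    simp only [hf x, dotProduct_neg]; ring
  have h00 : f ![0, 0] = 0 := (congrArg f (by decide)).trans h0
  have m0 := sum_mul_sq_eq_zero_of_bent hb ![1, 0]
  have m1 := sum_mul_sq_eq_zero_of_bent hb ![0, 1]
  have m2 := sum_mul_sq_eq_zero_of_bent hb ![1, 1]
  rw [sum_even (hev _)] at m0 m1 m2
  simp [dotProduct, Fin.sum_univ_two, points, toV] at m0 m1 m2
  -- The coefficients are read off at `(1, 0)`, `(0, 1)` and `(1, 1)`; `3` is the inverse of `2`.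
  refine ⟨3 * (f ![1, 0] - f ![2, 0]), 3 * (f ![1, 1] - f ![2, 2]) - 3 * (f ![1, 0] - f ![2, 0]) -
    3 * (f ![0, 1] - f ![0, 2]), 3 * (f ![0, 1] - f ![0, 2]), fun x => ?_⟩
  have hx : x = ![x 0, x 1] := by ext i; fin_cases i <;> rfl
  rw [hx]
  generalize x 0 = a, x 1 = b
  have h := fun a b => hf ![a, b]
  simp only [Matrix.neg_cons, Matrix.neg_empty] at h
  have e1 : f ![0, 4] = f ![0, 1] := h 0 1
  have e2 : f ![0, 3] = f ![0, 2] := h 0 2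
  have e3 : f ![4, 0] = f ![1, 0] := h 1 0
  have e4 : f ![3, 0] = f ![2, 0] := h 2 0
  have e5 : f ![4, 4] = f ![1, 1] := h 1 1
  have e6 : f ![3, 3] = f ![2, 2] := h 2 2
  have e7 : f ![4, 3] = f ![1, 2] := h 1 2
  have e8 : f ![3, 1] = f ![2, 4] := h 2 4
  have e9 : f ![4, 2] = f ![1, 3] := h 1 3
  have e10 : f ![3, 4] = f ![2, 1] := h 2 1
  have e11 : f ![4, 1] = f ![1, 4] := h 1 4
  have e12 : f ![3, 2] = f ![2, 3] := h 2 3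
  have two_smul : (2 : ZMod 5) • ![a, b] = ![2 * a, 2 * b] := by simp
  rw [two_smul, quad]
  simp only [Matrix.cons_val_zero, Matrix.cons_val_one]
  have t2 : (2 * 2 : ZMod 5) = 4 := rfl
  have t3 : (2 * 3 : ZMod 5) = 1 := rfl
  have t4 : (2 * 4 : ZMod 5) = 3 := rfl
  rcases zmod_five_cases a with rfl | rfl | rfl | rfl | rfl <;>
    rcases zmod_five_cases b with rfl | rfl | rfl | rfl | rfl <;>
    simp only [mul_zero, mul_one, t2, t3, t4, e1, e2, e3, e4, e5, e6, e7, e8, e9, e10, e11, e12]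
    <;> grind

/-! ### Boolean quantifiers over the integers modulo 5 -/

/-- Universal quantification over the numbers below `5`, as a Boolean. -/
def all5 (p : ℕ → Bool) : Bool := p 0 && (p 1 && (p 2 && (p 3 && p 4)))

/-- Existential quantification over the numbers below `5`, as a Boolean. -/
def any5 (p : ℕ → Bool) : Bool := p 0 || (p 1 || (p 2 || (p 3 || p 4)))

/-- The sum over the numbers below `5`. -/
def sum5 (g : ℕ → ℕ) : ℕ := g 0 + g 1 + g 2 + g 3 + g 4

theorem all5_eq_true {p : ℕ → Bool} : all5 p = true ↔ ∀ v : ZMod 5, p v.val = true := by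
  rw [forall_zmod_five]
  simp only [all5, Bool.and_eq_true]
  rfl

theorem any5_eq_true {p : ℕ → Bool} : any5 p = true ↔ ∃ v : ZMod 5, p v.val = true := by
  rw [← not_iff_not, not_exists, forall_zmod_five]
  simp only [any5, Bool.or_eq_true, not_or]
  rfl

theorem sum5_eq (g : ℕ → ℕ) : sum5 g = ∑ v : ZMod 5, g v.val :=
  (sum_zmod_five fun v => g v.val).symm

/-- `p n`, defined by a match on `n` so that kernel reduction evaluates `n` to a numeral before
substituting it into `p`. -/
def force (n : ℕ) (p : ℕ → Bool) : Bool :=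
  match n with
  | 0 => p 0
  | m + 1 => p (m + 1)

@[simp]
theorem force_eq (n : ℕ) (p : ℕ → Bool) : force n p = p n := by cases n <;> rfl

/-! ### Tables of the representatives and their equivalences -/

/-- The base-5 digit of `t` at position `i`. -/
def digit (t i : ℕ) : ℕ := t / 5 ^ i % 5

/-- The values of the representatives as numbers in base 5: the value at `(x, y)` is the digit at
position `5 x + y`. -/
def table : Fin 11 → ℕ := ![89149224768545460,
  27258780717344980,
  170725602799562500,
  224668123978407660,
  226987331057001560,
  46331502886563280,
  55874347612813280,
  141154197269252520,
  55849331206563280,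
  158878486285812800,
  234210968704657660]

theorem val_rep (i : Fin 11) (x : V 5 2) :
    (rep i x).val = digit (table i) (5 * (x 0).val + (x 1).val) := by
  revert i x; decide +kernel

theorem eq_of_eq_on_points {f g : V 5 2 → ZMod 5} (hf : Function.Even f) (hg : Function.Even g)
    (h0 : f 0 = g 0) (h : ∀ p ∈ points, f (toV p) = g (toV p)) (x : V 5 2) : f x = g x := by
  obtain rfl | ⟨p, hp, rfl | rfl⟩ := eq_zero_or_mem_points x
  · exact h0
  · exact h p hp
  · rw [hf, hg, h p hp]

/-- The values of `f` at `points`; they determine an even function with `f 0 = 0`. -/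
def evenTable (f : V 5 2 → ZMod 5) : List ℕ := points.map fun p => (f (toV p)).val

/-- The list of values at `points` that belongs to a base-5 table `t`. -/
def repTable (t : ℕ) : List ℕ := points.map fun p => digit t (5 * p.1 + p.2)

theorem evenTable_rep (i : Fin 11) : evenTable (rep i) = repTable (table i) := by
  refine List.map_congr_left fun p hp => ?_
  rw [val_rep]
  revert hp p
  simp only [points]
  simp [toV]

theorem val_add_mul (a b : ZMod 5) (x y : ℕ) :
    (a * x + b * y).val = (a.val * x + b.val * y) % 5 := by
  rw [← ZMod.val_natCast]
  push_cast
  simp only [ZMod.natCast_zmod_val]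

/-- The value of `g ∘ A` at `(x, y)`, where `g` is given by the base-5 table `t` and `A` has rows
`(a, b)` and `(c, d)`. -/
def tablePull (t a b c d x y : ℕ) : ℕ := digit t (5 * ((a * x + b * y) % 5) + (c * x + d * y) % 5)

theorem tablePull_table (i : Fin 11) (a b c d : ZMod 5) (p : ℕ × ℕ) :
    tablePull (table i) a.val b.val c.val d.val p.1 p.2 =
      (rep i (!![a, b; c, d] *ᵥ toV p)).val := by
  rw [val_rep, tablePull, ← val_add_mul, ← val_add_mul]
  simp [toV, Matrix.mulVec, dotProduct, Fin.sum_univ_two]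

/-- Boolean form of `IsPullback`, for `f` given by its values `L` at `points` and `g` given by its
base-5 table `t`. -/
def pullTest (t : ℕ) (L : List ℕ) (a b c d : ℕ) : Bool :=
  (List.zipWith (fun l p => Nat.beq l (tablePull t a b c d p.1 p.2)) L points).all id &&
    !(Nat.beq ((a * d + 4 * (b * c)) % 5) 0)

theorem rep_even (i : Fin 11) : Function.Even (rep i) := by
  revert i; unfold Function.Even; decide +kernel

theorem rep_zero (i : Fin 11) : rep i 0 = 0 := by
  revert i; decide +kernel

theorem pullTest_eq_true {f : V 5 2 → ZMod 5} (hf : Function.Even f) (h0 : f 0 = 0) (i : Fin 11)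
    (a b c d : ZMod 5) : pullTest (table i) (evenTable f) a.val b.val c.val d.val = true ↔
      IsPullback f (rep i) a b c d := by
  have hdet : (a.val * d.val + 4 * (b.val * c.val)) % 5 = (a * d - b * c).val := by
    rw [← ZMod.val_natCast]
    push_cast
    simp only [ZMod.natCast_zmod_val]
    congr 1
    have h5 : (5 : ZMod 5) = 0 := rfl
    linear_combination b * c * h5
  rw [pullTest, evenTable, List.zipWith_map_left, List.zipWith_self, List.all_map, hdet,
    Bool.and_eq_true, List.all_eq_true, IsPullback, and_comm]
  simp only [Function.comp_apply, id, Nat.beq_eq, tablePull_table, Bool.not_eq_true',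
    ← Bool.not_eq_true, ZMod.val_eq_zero, (ZMod.val_injective 5).eq_iff]
  refine and_congr_right fun _ => ⟨fun h =>
    eq_of_eq_on_points (g := fun x => rep i (!![a, b; c, d] *ᵥ x)) hf (fun x => ?_) ?_ h,
    fun h p _ => h _⟩
  · simp only [Matrix.mulVec_neg, rep_even i _]
  · rw [Matrix.mulVec_zero, rep_zero, h0]

/-- Search for a matrix `A` with `f = g ∘ A`; the first column is tested by itself before the
second one is chosen. -/
def hasPullback (t : ℕ) (L : List ℕ) : Bool :=
  any5 fun a => any5 fun c => Nat.beq (digit t (5 * a + c)) (L.getD 0 0) &&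
    any5 fun b => any5 fun d => pullTest t L a b c d

theorem exists_isPullback {f : V 5 2 → ZMod 5} (hf : Function.Even f) (h0 : f 0 = 0) (i : Fin 11)
    (h : hasPullback (table i) (evenTable f) = true) :
    f ∈ MulAction.orbit (GL (Fin 2) (ZMod 5)) (rep i) := by
  simp only [hasPullback, any5_eq_true, Bool.and_eq_true] at h
  obtain ⟨a, c, -, b, d, h⟩ := h
  exact (mem_orbit_iff _ _).2 ⟨a, b, c, d, (pullTest_eq_true hf h0 i a b c d).1 h⟩

/-- The number of matrices `A` with `f = g ∘ A`, with the same early test as in `hasPullback`. -/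
def countPullback (t : ℕ) (L : List ℕ) : ℕ :=
  sum5 fun a => sum5 fun c => bif Nat.beq (digit t (5 * a + c)) (L.getD 0 0) then
    sum5 fun b => sum5 fun d => bif pullTest t L a b c d then 1 else 0 else 0

theorem countPullback_eq {f : V 5 2 → ZMod 5} (hf : Function.Even f) (h0 : f 0 = 0) (i : Fin 11) :
    countPullback (table i) (evenTable f) = pullbackCount f (rep i) := by
  simp only [countPullback, pullbackCount, sum5_eq, cond_eq_ite, pullTest_eq_true hf h0]
  refine Finset.sum_congr rfl fun a _ => Finset.sum_congr rfl fun c _ => ?_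
  split_ifs with h
  · rfl
  · symm
    refine Finset.sum_eq_zero fun b _ => Finset.sum_eq_zero fun d _ => if_neg fun hp => h ?_
    have := hp.2 (toV (1, 0))
    rw [Nat.beq_eq]
    change _ = (f (toV (1, 0))).val
    rw [this, val_rep]
    simp [toV, Matrix.mulVec, dotProduct, Fin.sum_univ_two]

/-- No two distinct representatives are equivalent, and the stabilizer of `rep i` has order
`480 / orbitSize i`, where `480` is the order of `GL(2, 5)`. -/
theorem countPullback_table (i j : Fin 11) : countPullback (table j) (repTable (table i)) =
    if i = j then 480 / orbitSize i else 0 := by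
  revert i j; decide +kernel

/-! ### Value distributions as numbers -/

/-- For an even function with values `L` at `points`, and the values `W` of a linear form there:
the value distribution of the difference on the nonzero vectors, encoded in base 32. Here and below
`4 w` stands for `-w` modulo `5`, to avoid subtraction of natural numbers. -/
def hist (L W : List ℕ) : ℕ :=
  (List.zipWith (fun l w => 32 ^ ((l + w) % 5) + 32 ^ ((l + 4 * w) % 5)) L W).sum

/-- The values of the linear form `⟨u, ·⟩` at `points`. -/
def weights (u : ℕ × ℕ) : List ℕ := points.map fun p => (u.1 * p.1 + u.2 * p.2) % 5

/-- The base-32 encodings of the ten distributions that satisfy `HasPeak`. -/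
def peakCodes : List ℕ :=
  [4329609, 6494401, 4329764, 6494246, 4334724, 6489286, 4493444, 6330566, 9572484, 1251526]

/-- Membership in `peakCodes`. -/
def isPeakCode (n : ℕ) : Bool := force n fun n => peakCodes.any (Nat.beq n)

/-- The value distribution of `f - ⟨u, ·⟩`, encoded as a number in base 32. -/
def levelCode (f : V 5 2 → ZMod 5) (u : V 5 2) : ℕ := ∑ x, 32 ^ (f x - u ⬝ᵥ x).val

theorem levelCode_eq (f : V 5 2 → ZMod 5) (u : V 5 2) :
    levelCode f u = ∑ j, levelCount f u j * 32 ^ j.val := by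
  unfold levelCode
  rw [← Finset.sum_fiberwise Finset.univ (fun x => f x - u ⬝ᵥ x)]
  refine Finset.sum_congr rfl fun j _ => ?_
  rw [Finset.sum_congr rfl (g := fun _ => 32 ^ j.val), Finset.sum_const, smul_eq_mul]
  · rfl
  · intro x hx
    rw [(Finset.mem_filter.1 hx).2]

/-- The base-32 digits of a number, read off when their sum is `25`. -/
theorem digits_unique {a b c d e m : ℕ}
    (h : a * 32 ^ 0 + b * 32 ^ 1 + c * 32 ^ 2 + d * 32 ^ 3 + e * 32 ^ 4 = m)
    (hs : a + b + c + d + e = 25) :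
    a = m % 32 ∧ b = m / 32 % 32 ∧ c = m / 32 ^ 2 % 32 ∧ d = m / 32 ^ 3 % 32 ∧
      e = m / 32 ^ 4 := by
  have h1 : m / 32 = b + 32 * (c + 32 * (d + 32 * e)) := by omega
  have h2 : m / 32 ^ 2 = c + 32 * (d + 32 * e) := by
    rw [pow_two, ← Nat.div_div_eq_div_mul]; omega
  have h3 : m / 32 ^ 3 = d + 32 * e := by
    rw [pow_succ, ← Nat.div_div_eq_div_mul]; omega
  have h4 : m / 32 ^ 4 = e := by
    rw [pow_succ, ← Nat.div_div_eq_div_mul]; omega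
  omega

theorem isPeakCode_levelCode (f : V 5 2 → ZMod 5) (u : V 5 2) :
    isPeakCode (levelCode f u) = true ↔ HasPeak (levelCount f u) := by
  have hs := sum_levelCount f u
  rw [levelCode_eq]
  simp only [isPeakCode, force_eq, peakCodes]
  generalize levelCount f u = n at *
  rw [sum_zmod_five] at hs
  rw [sum_zmod_five, show ZMod.val (0 : ZMod 5) = 0 from rfl,
    show ZMod.val (1 : ZMod 5) = 1 from rfl, show ZMod.val (2 : ZMod 5) = 2 from rfl,
    show ZMod.val (3 : ZMod 5) = 3 from rfl, show ZMod.val (4 : ZMod 5) = 4 from rfl]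
  constructor
  · intro h
    rw [List.any_eq_true] at h
    obtain ⟨m, hm, h⟩ := h
    obtain ⟨h0, h1, h2, h3, h4⟩ := digits_unique (Nat.eq_of_beq_eq_true h) hs
    have key : ∀ m ∈ peakCodes, HasPeak fun j => (![m % 32, m / 32 % 32, m / 32 ^ 2 % 32,
      m / 32 ^ 3 % 32, m / 32 ^ 4] : Fin 5 → ℕ) j := by decide +kernel
    convert key m hm using 1
    rw [funext_iff, forall_zmod_five]
    exact ⟨h0, h1, h2, h3, h4⟩
  · have key1 : ∀ k : ZMod 5, isPeakCode ((if 0 = k then 9 else 4) * 32 ^ 0 +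
      (if 1 = k then 9 else 4) * 32 ^ 1 + (if 2 = k then 9 else 4) * 32 ^ 2 +
      (if 3 = k then 9 else 4) * 32 ^ 3 + (if 4 = k then 9 else 4) * 32 ^ 4) = true := by
      decide +kernel
    have key2 : ∀ k : ZMod 5, isPeakCode ((if 0 = k then 1 else 6) * 32 ^ 0 +
      (if 1 = k then 1 else 6) * 32 ^ 1 + (if 2 = k then 1 else 6) * 32 ^ 2 +
      (if 3 = k then 1 else 6) * 32 ^ 3 + (if 4 = k then 1 else 6) * 32 ^ 4) = true := by
      decide +kernel
    simp only [isPeakCode, force_eq, peakCodes] at key1 key2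
    rintro ⟨k, hk | hk⟩ <;> simp only [hk]
    · exact key1 k
    · exact key2 k

theorem levelCode_of_even {f : V 5 2 → ZMod 5} (hf : Function.Even f) (h0 : f 0 = 0)
    (u : ℕ × ℕ) : levelCode f (toV u) = 1 + hist (evenTable f) (weights u) := by
  rw [levelCode, sum_points, hist, evenTable, weights, List.zipWith_map, List.zipWith_self]
  refine congrArg₂ (· + ·) (by simp [h0]) ?_
  refine congrArg List.sum (List.map_congr_left fun p _ => ?_)
  have hu : toV u ⬝ᵥ toV p = ((u.1 * p.1 + u.2 * p.2 : ℕ) : ZMod 5) := by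
    simp [toV, dotProduct, Fin.sum_univ_two]
  have h5 : (5 : ZMod 5) = 0 := rfl
  rw [hf, dotProduct_neg, hu, add_comm]
  refine congrArg₂ (· + ·) (congrArg (32 ^ ·) ?_) (congrArg (32 ^ ·) ?_) <;>
    rw [← ZMod.val_natCast] <;> refine congrArg ZMod.val ?_ <;>
    push_cast [ZMod.natCast_zmod_val, ZMod.natCast_mod]
  · ring
  · linear_combination (-u.1 * p.1 - u.2 * p.2 : ZMod 5) * h5

theorem levelCode_zero_of_even {f : V 5 2 → ZMod 5} (hf : Function.Even f) (h0 : f 0 = 0) :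
    levelCode f 0 = 1 + 2 * (points.map fun p => 32 ^ (f (toV p)).val).sum := by
  simp only [levelCode, zero_dotProduct, sub_zero]
  rw [sum_even (g := fun x => 32 ^ (f x).val) fun x => by simp only [hf x], h0]
  simp

theorem isPeakCode_hist_table (i : Fin 11) (u : V 5 2) :
    isPeakCode (1 + hist (repTable (table i)) (weights ((u 0).val, (u 1).val))) = true := by
  revert i u; decide +kernel

theorem toV_val (u : V 5 2) : toV ((u 0).val, (u 1).val) = u := by
  ext i; fin_cases i <;> simp [toV]

theorem hasPeak_rep (i : Fin 11) (u : V 5 2) : HasPeak (levelCount (rep i) u) := by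
  rw [← isPeakCode_levelCode, ← toV_val u, levelCode_of_even (rep_even i) (rep_zero i),
    evenTable_rep]
  exact isPeakCode_hist_table i u

theorem rep_mem_evenBent (i : Fin 11) : rep i ∈ evenBent 5 2 :=
  ⟨rep_even i, (isBent_iff_hasPeak _).2 (hasPeak_rep i), rep_zero i⟩

/-! ### Search for even bent functions with given quadratic part -/

/-- The contribution of the values `v + q` and `v - q` to a base-32 distribution. -/
def pairCode (v q : ℕ) : ℕ := 32 ^ ((v + q) % 5) + 32 ^ ((v + 4 * q) % 5)

/-- Test `ok` for the tables of all functions `q + v` whose value distribution has a peak, where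
`q` is a quadratic form given by its values on the six lines, `v` is constant on each line, and
the values of `v` add up to `0`. -/
def search (ok : List ℕ → Bool) (q : ℕ → ℕ) : Bool :=
  all5 fun v0 => force (pairCode v0 (q 0)) fun s0 =>
  all5 fun v1 => force (s0 + pairCode v1 (q 1)) fun s1 =>
  all5 fun v2 => force (s1 + pairCode v2 (q 2)) fun s2 =>
  all5 fun v3 => force (s2 + pairCode v3 (q 3)) fun s3 =>
  all5 fun v4 => force (4 * (v0 + v1 + v2 + v3 + v4) % 5) fun v5 =>
    !(isPeakCode (1 + 2 * (s3 + (pairCode v4 (q 4) + pairCode v5 (q 5))))) ||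
    force ((v0 + q 0) % 5) fun a0 => force ((v0 + 4 * q 0) % 5) fun b0 =>
    force ((v1 + q 1) % 5) fun a1 => force ((v1 + 4 * q 1) % 5) fun b1 =>
    force ((v2 + q 2) % 5) fun a2 => force ((v2 + 4 * q 2) % 5) fun b2 =>
    force ((v3 + q 3) % 5) fun a3 => force ((v3 + 4 * q 3) % 5) fun b3 =>
    force ((v4 + q 4) % 5) fun a4 => force ((v4 + 4 * q 4) % 5) fun b4 =>
    force ((v5 + q 5) % 5) fun a5 => force ((v5 + 4 * q 5) % 5) fun b5 =>
      ok [a0, a1, a2, a3, a4, a5, b0, b1, b2, b3, b4, b5]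

/-- The values of the quadratic form with coefficients `a, b, c` at the first six `points`; the
first two need no reduction for coefficients below `5`. -/
def quadVals (a b c : ℕ) : ℕ → ℕ
  | 0 => a
  | 1 => c
  | k + 2 => (a + b * (k + 1) + c * ((k + 1) * (k + 1))) % 5

/-- Every even bent function whose quadratic part has coefficients `a, b, c` occurs in the search:
its values at `x` and `2 x` are `v + q` and `v - q`, and `∑ f = 0` gives the condition on `v`. -/
theorem test_of_search {ok : List ℕ → Bool} {a b c : ℕ} (h : search ok (quadVals a b c) = true)
    {f : V 5 2 → ZMod 5} (hf : Function.Even f) (h0 : f 0 = 0)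
    (hb : ∀ u, HasPeak (levelCount f u))
    (hq : ∀ x, f x - f ((2 : ZMod 5) • x) = 2 * quad a b c x) : ok (evenTable f) = true := by
  simp only [search, all5_eq_true, force_eq, Bool.or_eq_true, Bool.not_eq_true',
    ← Bool.not_eq_true] at h
  have hsum := sum_eq_zero_of_bent hb
  have h5 : (5 : ZMod 5) = 0 := rfl
  let q : ℕ → ZMod 5 := fun k => quadVals a b c k
  have key : ∀ x y k, (2 : ZMod 5) • toV x = toV y → quad a b c (toV x) = q k →
      ((f (toV x) - q k).val + quadVals a b c k) % 5 = (f (toV x)).val ∧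
      ((f (toV x) - q k).val + 4 * quadVals a b c k) % 5 = (f (toV y)).val ∧
      f (toV x) - f (toV y) = 2 * q k := by
    intro x y k hy hk
    rw [← ZMod.val_natCast, ← ZMod.val_natCast]
    push_cast
    simp only [ZMod.natCast_zmod_val]
    have := hq (toV x)
    rw [hy, hk] at this
    refine ⟨congrArg ZMod.val ?_, congrArg ZMod.val ?_, this⟩
    · exact sub_add_cancel _ _
    · linear_combination this + q k * h5
  have hquad : ∀ k : ℕ, quad a b c (toV (1, k + 1)) = q (k + 2) := fun k => by
    simp only [quad, toV, q, quadVals, ZMod.natCast_mod, Matrix.cons_val_zero, Matrix.cons_val_one]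
    push_cast
    ring
  obtain ⟨i0, j0, k0⟩ := key (1, 0) (2, 0) 0 (by decide) (by simp [quad, toV, q, quadVals])
  obtain ⟨i1, j1, k1⟩ := key (0, 1) (0, 2) 1 (by decide) (by simp [quad, toV, q, quadVals])
  obtain ⟨i2, j2, k2⟩ := key (1, 1) (2, 2) 2 (by decide) (by simpa using hquad 0)
  obtain ⟨i3, j3, k3⟩ := key (1, 2) (2, 4) 3 (by decide) (by simpa using hquad 1)
  obtain ⟨i4, j4, k4⟩ := key (1, 3) (2, 1) 4 (by decide) (by simpa using hquad 2)
  obtain ⟨i5, j5, k5⟩ := key (1, 4) (2, 3) 5 (by decide) (by simpa using hquad 3)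
  rw [sum_even hf, h0] at hsum
  simp only [points, List.map_cons, List.map_nil, List.sum_cons, List.sum_nil] at hsum
  have hlast : 4 * ((f (toV (1, 0)) - q 0).val + (f (toV (0, 1)) - q 1).val +
      (f (toV (1, 1)) - q 2).val + (f (toV (1, 2)) - q 3).val + (f (toV (1, 3)) - q 4).val) % 5 =
      (f (toV (1, 4)) - q 5).val := by
    rw [← ZMod.val_natCast]
    refine congrArg ZMod.val ?_
    push_cast
    simp only [ZMod.natCast_zmod_val]
    clear_value q
    generalize f (toV (1, 0)) = A0, f (toV (0, 1)) = A1, f (toV (1, 1)) = A2,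
      f (toV (1, 2)) = A3, f (toV (1, 3)) = A4, f (toV (1, 4)) = A5, f (toV (2, 0)) = B0,
      f (toV (0, 2)) = B1, f (toV (2, 2)) = B2, f (toV (2, 4)) = B3, f (toV (2, 1)) = B4,
      f (toV (2, 3)) = B5 at *
    linear_combination hsum + 2 * (k0 + k1 + k2 + k3 + k4 + k5) - (A5 - q 5) * h5
  specialize h (f (toV (1, 0)) - q 0) (f (toV (0, 1)) - q 1) (f (toV (1, 1)) - q 2)
    (f (toV (1, 2)) - q 3) (f (toV (1, 3)) - q 4)
  simp only [pairCode, hlast, i0, i1, i2, i3, i4, i5, j0, j1, j2, j3, j4, j5] at h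
  refine h.resolve_left (not_not_intro ?_)
  have hpeak := (isPeakCode_levelCode f 0).2 (hb 0)
  rw [levelCode_zero_of_even hf h0] at hpeak
  convert hpeak using 3
  simp only [points, List.map_cons, List.map_nil, List.sum_cons, List.sum_nil]
  ring

/-- Either the distribution of `f - ⟨u, ·⟩` has no peak for some `u` in `D`, so that `f` is not
bent, or `f` is equivalent to `rep i` for some `i` in `I`. -/
def leafTest (D : List (ℕ × ℕ)) (I : List (Fin 11)) (L : List ℕ) : Bool :=
  (D.any fun u => !(isPeakCode (1 + hist L (weights u)))) ||
    I.any fun i => force (table i) fun t => hasPullback t L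

/-- A vector in each of the six lines through `0`. -/
def dirs : List (ℕ × ℕ) := [(0, 1), (1, 0), (1, 1), (1, 2), (1, 3), (1, 4)]

theorem mem_orbit_of_leafTest {D : List (ℕ × ℕ)} {I : List (Fin 11)}
    {f : V 5 2 → ZMod 5} (hf : Function.Even f) (h0 : f 0 = 0)
    (hb : ∀ u, HasPeak (levelCount f u)) (h : leafTest D I (evenTable f) = true) :
    ∃ i, f ∈ MulAction.orbit (GL (Fin 2) (ZMod 5)) (rep i) := by
  simp only [leafTest, Bool.or_eq_true, List.any_eq_true, force_eq, Bool.not_eq_true',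
    ← Bool.not_eq_true] at h
  rcases h with ⟨u, -, hu⟩ | ⟨i, -, hi⟩
  · rw [← levelCode_of_even hf h0, isPeakCode_levelCode] at hu
    exact absurd (hb _) hu
  · exact ⟨i, exists_isPullback hf h0 i hi⟩

-- The last arguments of `leafTest` are the representatives with the given quadratic part, up to
-- equivalence.

theorem search_100 : search (leafTest dirs [9]) (quadVals 1 0 0) = true := by
  decide +kernel

theorem search_200 : search (leafTest dirs [10]) (quadVals 2 0 0) = true := by
  decide +kernel

theorem search_010 : search (leafTest dirs [1, 2, 3, 6, 7]) (quadVals 0 1 0) = true := by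
  decide +kernel

theorem search_103 : search (leafTest dirs [0]) (quadVals 1 0 3) = true := by
  decide +kernel

/-- Every function with zero quadratic part that passes the test for `u = 0` is bent, so no further
`u` is needed here. -/
theorem search_000 : search (leafTest [] [4, 5, 8]) (quadVals 0 0 0) = true := by
  decide +kernel

/-! ### Normal forms and the classification -/

/-- Coefficients of binary quadratic forms over `GF(5)`, one for each equivalence class: the zero
form, the two classes of rank one, the hyperbolic form and the anisotropic form. -/
def normalForms : List (ℕ × ℕ × ℕ) := [(0, 0, 0), (1, 0, 0), (2, 0, 0), (0, 1, 0), (1, 0, 3)]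

/-- Search for a change of variables that takes the quadratic form with coefficients `a, b, c` to
one of the normal forms. -/
def quadReduces (a b c : ℕ) : Bool :=
  normalForms.any fun n => any5 fun p => any5 fun r =>
    Nat.beq ((a * (p * p) + b * (p * r) + c * (r * r)) % 5) n.1 &&
    any5 fun q => any5 fun s => !(Nat.beq ((p * s + 4 * (q * r)) % 5) 0) &&
      (Nat.beq ((a * (q * q) + b * (q * s) + c * (s * s)) % 5) n.2.2 &&
      Nat.beq ((2 * a * (p * q) + b * (p * s + q * r) + 2 * c * (r * s)) % 5) n.2.1)

theorem quadReduces_all : all5 (fun a => all5 fun b => all5 fun c => quadReduces a b c) = true := by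
  decide +kernel

theorem exists_normalForm (a b c : ZMod 5) : ∃ n ∈ normalForms, ∃ φ : GL (Fin 2) (ZMod 5),
    ∀ x, quad a b c ((φ⁻¹).val *ᵥ x) = quad n.1 n.2.1 n.2.2 x := by
  have h := quadReduces_all
  simp only [all5_eq_true] at h
  have h := h a b c
  simp only [quadReduces, List.any_eq_true, any5_eq_true, Bool.and_eq_true, Bool.not_eq_true',
    ← Bool.not_eq_true, Nat.beq_eq] at h
  obtain ⟨n, hn, p, r, h1, q, s, hdet, h3, h2⟩ := h
  have cast : ∀ {m k : ℕ}, m % 5 = k → (m : ZMod 5) = k := fun h => by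
    rw [← h, ZMod.natCast_mod]
  have h5 : (5 : ZMod 5) = 0 := rfl
  replace h1 := cast h1
  replace h2 := cast h2
  replace h3 := cast h3
  push_cast [ZMod.natCast_zmod_val] at h1 h2 h3
  have hdet' : p * s - q * r ≠ 0 := fun h0 => hdet <| by
    have : ((p.val * s.val + 4 * (q.val * r.val) : ℕ) : ZMod 5) = 0 := by
      push_cast [ZMod.natCast_zmod_val]
      linear_combination h0 + q * r * h5
    rwa [ZMod.natCast_eq_zero_iff, Nat.dvd_iff_mod_eq_zero] at this
  refine ⟨n, hn, (Matrix.GeneralLinearGroup.mkOfDetNeZero !![p, q; r, s]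
    (by rwa [Matrix.det_fin_two_of]))⁻¹, fun x => ?_⟩
  rw [inv_inv]
  change quad a b c (!![p, q; r, s] *ᵥ x) = _
  simp only [quad, ← h1, ← h2, ← h3, Matrix.mulVec, dotProduct, Fin.sum_univ_two, Matrix.of_apply,
    Matrix.cons_val_zero, Matrix.cons_val_one]
  ring

/-- After a change of variables the quadratic part of `f` is a normal form, and the search
applies. -/
theorem exists_mem_orbit_rep {f : V 5 2 → ZMod 5} (hf : f ∈ evenBent 5 2) :
    ∃ i, f ∈ MulAction.orbit (GL (Fin 2) (ZMod 5)) (rep i) := by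
  obtain ⟨a, b, c, hq⟩ := exists_quad_of_bent hf.1 hf.2.2 ((isBent_iff_hasPeak f).1 hf.2.1)
  obtain ⟨n, hn, φ, hφ⟩ := exists_normalForm a b c
  obtain ⟨he, hb, h0⟩ := smul_mem_evenBent φ hf
  rw [isBent_iff_hasPeak] at hb
  have hq' : ∀ x, (φ • f) x - (φ • f) ((2 : ZMod 5) • x) = 2 * quad n.1 n.2.1 n.2.2 x := by
    intro x
    rw [smul_apply, smul_apply, Matrix.mulVec_smul, hq, hφ]
  suffices h : ∃ i, φ • f ∈ MulAction.orbit (GL (Fin 2) (ZMod 5)) (rep i) by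
    obtain ⟨i, hi⟩ := h
    exact ⟨i, by simpa only [inv_smul_smul] using MulAction.mem_orbit_of_mem_orbit φ⁻¹ hi⟩
  simp only [normalForms, List.mem_cons, List.not_mem_nil, or_false] at hn
  rcases hn with rfl | rfl | rfl | rfl | rfl
  · exact mem_orbit_of_leafTest he h0 hb (test_of_search search_000 he h0 hb hq')
  · exact mem_orbit_of_leafTest he h0 hb (test_of_search search_100 he h0 hb hq')
  · exact mem_orbit_of_leafTest he h0 hb (test_of_search search_200 he h0 hb hq')
  · exact mem_orbit_of_leafTest he h0 hb (test_of_search search_010 he h0 hb hq')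
  · exact mem_orbit_of_leafTest he h0 hb (test_of_search search_103 he h0 hb hq')

theorem pullbackCount_rep (i j : Fin 11) :
    pullbackCount (rep i) (rep j) = if i = j then 480 / orbitSize i else 0 := by
  rw [← countPullback_eq (rep_even i) (rep_zero i), evenTable_rep, countPullback_table]

theorem eq_of_rep_mem_orbit {i j : Fin 11}
    (h : rep i ∈ MulAction.orbit (GL (Fin 2) (ZMod 5)) (rep j)) : i = j := by
  by_contra hij
  refine (pullbackCount_eq_zero_iff (rep i) (rep j)).1 ?_ h
  rw [pullbackCount_rep, if_neg hij]

theorem ncard_orbit_rep (i : Fin 11) :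
    (MulAction.orbit (GL (Fin 2) (ZMod 5)) (rep i)).ncard = orbitSize i := by
  have h := ncard_orbit_mul_pullbackCount (rep i)
  rw [pullbackCount_rep, if_pos rfl] at h
  have h1 : orbitSize i * (480 / orbitSize i) = 480 ∧ 0 < 480 / orbitSize i := by
    clear h; revert i; decide
  exact Nat.eq_of_mul_eq_mul_right h1.2 (h.trans h1.1.symm)

theorem orbit_rep_subset (i : Fin 11) :
    MulAction.orbit (GL (Fin 2) (ZMod 5)) (rep i) ⊆ evenBent 5 2 := by
  rintro _ ⟨φ, rfl⟩
  exact smul_mem_evenBent φ (rep_mem_evenBent i)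

theorem evenBent_eq_iUnion :
    evenBent 5 2 = ⋃ i, MulAction.orbit (GL (Fin 2) (ZMod 5)) (rep i) := by
  refine Set.Subset.antisymm (fun f hf => Set.mem_iUnion.2 (exists_mem_orbit_rep hf)) ?_
  exact Set.iUnion_subset orbit_rep_subset

theorem orbit_rep_injective :
    Function.Injective fun i => MulAction.orbit (GL (Fin 2) (ZMod 5)) (rep i) :=
  fun _ _ h => eq_of_rep_mem_orbit (MulAction.orbit_eq_iff.1 h)

theorem ncard_evenBent : (evenBent 5 2).ncard = 1420 := by
  rw [evenBent_eq_iUnion, Set.ncard_iUnion_of_finite]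
  · simp only [ncard_orbit_rep, finsum_eq_sum_of_fintype]
    decide
  · exact fun i => Set.toFinite _
  · intro i j hij
    refine (MulAction.orbit.eq_or_disjoint (G := GL (Fin 2) (ZMod 5)) (rep i) (rep j)).resolve_left
      fun h => hij (orbit_rep_injective h)

theorem ncard_image_orbit :
    (MulAction.orbit (GL (Fin 2) (ZMod 5)) '' evenBent 5 2).ncard = 11 := by
  have : MulAction.orbit (GL (Fin 2) (ZMod 5)) '' evenBent 5 2 =
      Set.range fun i => MulAction.orbit (GL (Fin 2) (ZMod 5)) (rep i) := by
    ext s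
    constructor
    · rintro ⟨f, hf, rfl⟩
      obtain ⟨i, hi⟩ := exists_mem_orbit_rep hf
      exact ⟨i, (MulAction.orbit_eq_iff.2 hi).symm⟩
    · rintro ⟨i, rfl⟩
      exact ⟨rep i, rep_mem_evenBent i, rfl⟩
  rw [this, ← Set.image_univ, Set.ncard_image_of_injective _ orbit_rep_injective,
    Set.ncard_univ, Nat.card_eq_fintype_card, Fintype.card_fin]

/-! ### Weighted partial difference sets -/

/-- The number of `x` with `f x = a` and `f (x - g) = b`. -/
def shiftCount (f : V 5 2 → ZMod 5) (a b : ZMod 5) (g : V 5 2) : ℕ :=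
  ∑ x, if f x = a ∧ f (x - g) = b then 1 else 0

theorem diffCount_levelCurve (f : V 5 2 → ZMod 5) (a b : {a : ZMod 5 // a ≠ 0}) (g : V 5 2) :
    diffCount (levelCurve f a) (levelCurve f b) g = shiftCount f a b g := by
  rw [shiftCount, ← Finset.card_filter, diffCount]
  refine Finset.card_bij' (fun d _ => d.1) (fun x _ => (x, x - g)) ?_ ?_ ?_ ?_
  · rintro ⟨d, e⟩ h
    simp only [levelCurve, Finset.mem_filter, Finset.mem_product, Finset.mem_univ, true_and] at h ⊢
    rw [← h.2, sub_sub_cancel]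
    exact h.1
  · intro x h
    simpa [levelCurve] using h
  · rintro ⟨d, e⟩ h
    simp only [Finset.mem_filter] at h
    rw [← h.2, sub_sub_cancel]
  · intro x _
    rfl

/-- The number of ways to write a nonzero `g` as a difference of elements of `f⁻¹(a)` and `f⁻¹(b)`
depends only on `f g`. -/
def IsRegular (f : V 5 2 → ZMod 5) : Prop :=
  ∀ a b : ZMod 5, a ≠ 0 → b ≠ 0 → ∀ g h : V 5 2, g ≠ 0 → h ≠ 0 → f g = f h →
    shiftCount f a b g = shiftCount f a b h

/-- For an even function with `f 0 = 0` all other conditions on a weighted PDS hold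
automatically. -/
theorem givesWeightedPDS_iff {f : V 5 2 → ZMod 5} (hf : Function.Even f) (h0 : f 0 = 0) :
    GivesWeightedPDS f ↔ IsRegular f := by
  constructor
  · rintro ⟨v, k, lam, mu, h⟩ a b ha hb g g' hg hg' hfg
    have e1 := diffCount_levelCurve f ⟨a, ha⟩ ⟨b, hb⟩ g
    have e2 := diffCount_levelCurve f ⟨a, ha⟩ ⟨b, hb⟩ g'
    rw [← e1, ← e2]
    by_cases hz : f g = 0
    · have aux : ∀ x, f x = 0 → ∀ l, x ∉ levelCurve f l := fun x hx l hl => by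
        simp only [levelCurve, Finset.mem_filter] at hl
        exact l.2 (hl.2.symm.trans hx)
      rw [h.count_notMem _ _ g (aux g hz) hg, h.count_notMem _ _ g' (aux g' (hfg ▸ hz)) hg']
    · rw [h.count_mem _ _ ⟨f g, hz⟩ g (by simp [levelCurve]) hg,
        h.count_mem _ _ ⟨f g, hz⟩ g' (by simp [levelCurve, hfg]) hg']
  · intro h
    classical
    -- the value of the count at any nonzero point of a given level, if there is one
    let val : ZMod 5 → ZMod 5 → ZMod 5 → ℕ := fun a b c =>
      if hx : ∃ x : V 5 2, x ≠ 0 ∧ f x = c then shiftCount f a b hx.choose else 0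
    have hval : ∀ a b : ZMod 5, a ≠ 0 → b ≠ 0 → ∀ g : V 5 2, g ≠ 0 →
        shiftCount f a b g = val a b (f g) := fun a b ha hb g hg => by
      have hx : ∃ x : V 5 2, x ≠ 0 ∧ f x = f g := ⟨g, hg, rfl⟩
      simp only [val, dif_pos hx]
      exact h a b ha hb _ _ hg hx.choose_spec.1 hx.choose_spec.2.symm
    refine ⟨_, fun a => (levelCurve f a).card, fun a b c => val a b c, fun a b => val a b 0,
      ⟨rfl, fun _ => rfl, ?_, ?_, ?_, ?_, ?_⟩⟩
    · intro a b hab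
      rw [Finset.disjoint_left]
      intro x hx hx'
      simp only [levelCurve, Finset.mem_filter] at hx hx'
      exact hab (Subtype.ext (hx.2.symm.trans hx'.2))
    · intro a ha
      simp only [levelCurve, Finset.mem_filter] at ha
      exact a.2 (ha.2.symm.trans h0)
    · intro a b c g hg hg0
      simp only [levelCurve, Finset.mem_filter] at hg
      rw [diffCount_levelCurve, hval _ _ a.2 b.2 g hg0, hg.2]
    · intro a b g hg hg0
      have hz : f g = 0 := by
        by_contra hz
        exact hg ⟨f g, hz⟩ (by simp [levelCurve])
      rw [diffCount_levelCurve, hval _ _ a.2 b.2 g hg0, hz]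
    · exact fun a => ⟨a, fun g => by simp [levelCurve, hf g]⟩

theorem shiftCount_smul (φ : GL (Fin 2) (ZMod 5)) (f : V 5 2 → ZMod 5) (a b : ZMod 5)
    (g : V 5 2) : shiftCount (φ • f) a b g = shiftCount f a b ((φ⁻¹).val *ᵥ g) := by
  unfold shiftCount
  symm
  rw [← Equiv.sum_comp (mulVecEquiv φ⁻¹)]
  refine Finset.sum_congr rfl fun x _ => ?_
  rw [smul_apply, smul_apply, Matrix.mulVec_sub]
  rfl

theorem IsRegular.smul {f : V 5 2 → ZMod 5} (h : IsRegular f) (φ : GL (Fin 2) (ZMod 5)) :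
    IsRegular (φ • f) := by
  have hne : ∀ g : V 5 2, g ≠ 0 → (φ⁻¹).val *ᵥ g ≠ 0 := fun g hg h0 => hg <| by
    rw [← val_mulVec_inv_val_mulVec φ g, h0, Matrix.mulVec_zero]
  intro a b ha hb g g' hg hg' hfg
  rw [shiftCount_smul, shiftCount_smul]
  exact h a b ha hb _ _ (hne g hg) (hne g' hg') hfg

theorem isRegular_iff_of_mem_orbit {f g : V 5 2 → ZMod 5}
    (h : f ∈ MulAction.orbit (GL (Fin 2) (ZMod 5)) g) : IsRegular f ↔ IsRegular g := by
  obtain ⟨φ, rfl⟩ := h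
  exact ⟨fun h => by simpa only [inv_smul_smul] using h.smul φ⁻¹, fun h => h.smul φ⟩

/-- `shiftCount` for the function with base-5 table `t`. -/
def tableShiftCount (t a b : ℕ) (g : ℕ × ℕ) : ℕ :=
  sum5 fun x => sum5 fun y => bif Nat.beq (digit t (5 * x + y)) a &&
    Nat.beq (digit t (5 * ((x + 4 * g.1) % 5) + (y + 4 * g.2) % 5)) b then 1 else 0

theorem tableShiftCount_eq (i : Fin 11) (a b : ZMod 5) (g : V 5 2) :
    tableShiftCount (table i) a.val b.val ((g 0).val, (g 1).val) = shiftCount (rep i) a b g := by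
  rw [tableShiftCount, shiftCount, sum_V, sum5_eq]
  refine Finset.sum_congr rfl fun x _ => ?_
  rw [sum5_eq]
  refine Finset.sum_congr rfl fun y _ => ?_
  have hsub : ∀ x y : ZMod 5, (x.val + 4 * y.val) % 5 = (x - y).val := fun x y => by
    have h5 : (5 : ZMod 5) = 0 := rfl
    rw [← ZMod.val_natCast]
    refine congrArg ZMod.val ?_
    push_cast [ZMod.natCast_zmod_val]
    linear_combination y * h5
  have e1 := val_rep i ![x, y]
  have e2 := val_rep i (![x, y] - g)
  simp only [Matrix.cons_val_zero, Matrix.cons_val_one, Pi.sub_apply] at e1 e2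
  rw [hsub, hsub, ← e1, ← e2, cond_eq_ite]
  simp only [Bool.and_eq_true, Nat.beq_eq, (ZMod.val_injective 5).eq_iff]

/-- A nonzero point at which the function with table `t` takes the value `c`. If there is none, the
result is irrelevant, as nothing is compared with it. -/
def levelPoint (t c : ℕ) : ℕ × ℕ :=
  (points.find? fun p => Nat.beq (digit t (5 * p.1 + p.2)) c).getD (0, 0)

/-- Boolean form of `IsRegular` for the function with base-5 table `t`: each count is compared with
the one at `levelPoint`. -/
def tableRegular (t : ℕ) : Bool :=
  all5 fun a => all5 fun b => all5 fun c => Nat.beq a 0 || (Nat.beq b 0 ||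
    force (tableShiftCount t a b (levelPoint t c)) fun m =>
    all5 fun x => all5 fun y => Nat.beq (x + y) 0 || (!(Nat.beq (digit t (5 * x + y)) c) ||
      Nat.beq (tableShiftCount t a b (x, y)) m))

theorem isRegular_of_tableRegular {i : Fin 11} (h : tableRegular (table i) = true) :
    IsRegular (rep i) := by
  simp only [tableRegular, all5_eq_true, force_eq, Bool.or_eq_true, Nat.beq_eq, Bool.not_eq_true',
    ← Bool.not_eq_true] at h
  intro a b ha hb g g' hg hg' hfg
  have key : ∀ g : V 5 2, g ≠ 0 → shiftCount (rep i) a b g =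
      tableShiftCount (table i) a.val b.val (levelPoint (table i) (rep i g).val) := by
    intro g hg
    have := h a b (rep i g)
    rw [ZMod.val_eq_zero, ZMod.val_eq_zero] at this
    have := (this.resolve_left ha).resolve_left hb (g 0) (g 1)
    rw [← val_rep, tableShiftCount_eq] at this
    refine (this.resolve_left fun h0 => hg ?_).resolve_left (not_not_intro rfl)
    have h0' := Nat.add_eq_zero_iff.1 h0
    ext k
    fin_cases k
    · exact (ZMod.val_eq_zero _).1 h0'.1
    · exact (ZMod.val_eq_zero _).1 h0'.2
  rw [key g hg, key g' hg', hfg]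

theorem tableRegular_table : ∀ i ∈ pdsIndices, tableRegular (table i) = true := by
  decide +kernel

theorem not_isRegular_rep (i : Fin 11) (hi : i ∉ pdsIndices) : ¬ IsRegular (rep i) := by
  have key : ∀ (i : Fin 11) (a b : ZMod 5) (g h : V 5 2), a ≠ 0 → b ≠ 0 → g ≠ 0 → h ≠ 0 →
      rep i g = rep i h →
      tableShiftCount (table i) a.val b.val ((g 0).val, (g 1).val) ≠
        tableShiftCount (table i) a.val b.val ((h 0).val, (h 1).val) →
      ¬ IsRegular (rep i) := fun i a b g h ha hb hg hh he hn hr => by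
    rw [tableShiftCount_eq, tableShiftCount_eq] at hn
    exact hn (hr a b ha hb g h hg hh he)
  have : i = 2 ∨ i = 3 ∨ i = 6 ∨ i = 7 ∨ i = 9 ∨ i = 10 := by revert i; decide
  rcases this with rfl | rfl | rfl | rfl | rfl | rfl
  · exact key _ 1 1 ![0, 1] ![1, 0] (by decide) (by decide) (by decide) (by decide)
      (by decide +kernel) (by decide +kernel)
  · exact key _ 1 2 ![1, 0] ![2, 2] (by decide) (by decide) (by decide) (by decide)
      (by decide +kernel) (by decide +kernel)
  · exact key _ 2 2 ![1, 0] ![1, 1] (by decide) (by decide) (by decide) (by decide)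
      (by decide +kernel) (by decide +kernel)
  · exact key _ 1 1 ![0, 2] ![1, 0] (by decide) (by decide) (by decide) (by decide)
      (by decide +kernel) (by decide +kernel)
  · exact key _ 1 1 ![0, 1] ![2, 3] (by decide) (by decide) (by decide) (by decide)
      (by decide +kernel) (by decide +kernel)
  · exact key _ 1 1 ![0, 1] ![2, 2] (by decide) (by decide) (by decide) (by decide)
      (by decide +kernel) (by decide +kernel)

theorem isRegular_rep_iff (i : Fin 11) : IsRegular (rep i) ↔ i ∈ pdsIndices :=
  ⟨fun h => by_contra fun hi => not_isRegular_rep i hi h,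
    fun hi => isRegular_of_tableRegular (tableRegular_table i hi)⟩

theorem givesWeightedPDS_iff_of_mem_orbit {f : V 5 2 → ZMod 5} (hf : f ∈ evenBent 5 2)
    {i : Fin 11} (h : f ∈ MulAction.orbit (GL (Fin 2) (ZMod 5)) (rep i)) :
    GivesWeightedPDS f ↔ i ∈ pdsIndices := by
  rw [givesWeightedPDS_iff hf.1 hf.2.2, isRegular_iff_of_mem_orbit h, isRegular_rep_iff]

end BentGF

theorem mainTheorem3 :
    -- there are exactly 1420 even bent functions with `f 0 = 0`
    (BentGF.evenBent 5 2).ncard = 1420 ∧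
    -- `GL(2, GF(5))` acts on the set of these functions
    (∀ φ : GL (Fin 2) (ZMod 5), ∀ f ∈ BentGF.evenBent 5 2, φ • f ∈ BentGF.evenBent 5 2) ∧
    -- there are exactly 11 orbits
    (MulAction.orbit (GL (Fin 2) (ZMod 5)) '' BentGF.evenBent 5 2).ncard = 11 ∧
    -- `f₁, …, f₁₁` lie in the set, in distinct orbits, and every orbit is the orbit of some `f_i`
    (∀ i, BentGF.rep i ∈ BentGF.evenBent 5 2) ∧
    (∀ i j, BentGF.rep i ∈ MulAction.orbit (GL (Fin 2) (ZMod 5)) (BentGF.rep j) → i = j) ∧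
    (∀ f ∈ BentGF.evenBent 5 2,
      ∃ i, f ∈ MulAction.orbit (GL (Fin 2) (ZMod 5)) (BentGF.rep i)) ∧
    -- the orbit of `f_i` has the stated size
    (∀ i, (MulAction.orbit (GL (Fin 2) (ZMod 5)) (BentGF.rep i)).ncard = BentGF.orbitSize i) ∧
    -- among `f₁, …, f₁₁` exactly `f₁, f₂, f₅, f₆, f₉` give rise to a weighted PDS
    (∀ i, BentGF.GivesWeightedPDS (BentGF.rep i) ↔ i ∈ BentGF.pdsIndices) ∧
    -- among all the functions, exactly those in the orbits of `f₁, f₂, f₅, f₆, f₉` do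
    (∀ f ∈ BentGF.evenBent 5 2, BentGF.GivesWeightedPDS f ↔
      ∃ i ∈ BentGF.pdsIndices,
        f ∈ MulAction.orbit (GL (Fin 2) (ZMod 5)) (BentGF.rep i)) := by
  refine ⟨BentGF.ncard_evenBent, fun φ f hf => BentGF.smul_mem_evenBent φ hf,
    BentGF.ncard_image_orbit, BentGF.rep_mem_evenBent, fun _ _ => BentGF.eq_of_rep_mem_orbit,
    fun f hf => BentGF.exists_mem_orbit_rep hf, BentGF.ncard_orbit_rep,
    fun i => BentGF.givesWeightedPDS_iff_of_mem_orbit (BentGF.rep_mem_evenBent i)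
      (MulAction.mem_orbit_self _), fun f hf => ⟨fun h => ?_, ?_⟩⟩
  · obtain ⟨i, hi⟩ := BentGF.exists_mem_orbit_rep hf
    exact ⟨i, (BentGF.givesWeightedPDS_iff_of_mem_orbit hf hi).1 h, hi⟩
  · rintro ⟨i, hi, hfi⟩
    exact (BentGF.givesWeightedPDS_iff_of_mem_orbit hf hfi).2 hi
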